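/- **Setting.** Let $\Omega$ be a measurable space with a measure $\mu$ (for instance a finite set with counting measure, or a Euclidean rectangle with its Borel $\sigma$-algebra and Lebesgue measure). A *partition tree* consists of partitions $\mathcal A^k=\{A_{k,1},\dots,A_{k,2^k}\}$ of $\Omega$, $k=0,1,2,\dots$, with $\mathcal A^0=\{\Omega\}$, such that each $A=A_{k,m}$ (a *node* of level $k$) is the disjoint union of its left child $A_l=A_{k+1,2m-1}$ and its right child $A_r=A_{k+1,2m}$, and such that the sets $A_{k,m}$ together generate the $\sigma$-algebra of $\Omega$. Sets may be empty, and nodes are distinguished by their labels $(k,m)$. Write $A_p$ for the parent of a node $A\ne\Omega$ (that is, $A$ is not the root). Let $I\ge 1$ be an integer and let $Q_0$ be a probability measure on $\Omega$; put $\theta_0(A)=Q_0(A_l)/Q_0(A)$ if $Q_0(A)>0$ and $\theta_0(A)=0$ otherwise. Let $(\gamma_i(\Omega))_{i\le I}$ be a probability vector and, for each node $A\neq\Omega$, let $(\gamma_{i,i'}(A))_{i,i'\le I}$ be a stochastic matrix. For each node $A$ let $F^1_{\nu(A)},\dots,F^I_{\nu(A)}$ be probability measures on $(0,\infty]$ in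 (weakly) increasing stochastic order. A random probability measure $Q$ on $\Omega$ has the *Markov-APT distribution* with these parameters if its law is the law of a random probability measure that satisfies, almost surely, $$Q(A_l)=\theta(A)\,Q(A),\qquad Q(A_r)=(1-\theta(A))\,Q(A)\qquad\text{for all nodes }A,$$ where the coefficients $\theta(A)$ are generated by the following hierarchical model: 1. the states $C(A)\in\{1,\dots,I\}$ form a Markov tree: $P(C(\Omega)=i)=\gamma_i(\Omega)$, and for every finite set $t$ of nodes that contains the root and the parent of each of its other members, and all states $c(A)$, $$P\bigl(C(A)=c(A)\ \forall A\in t\bigr)=\gamma_{c(\Omega)}(\Omega)\prod_{A\in t,\,A\ne\Omega}\gamma_{c(A_p),c(A)}(A);$$ 2. given all the states, the $\nu(A)$ are independent and $\nu(A)\sim F^{i}_{\nu(A)}$ with $i=C(A)$; 3. given all the states and all the $\nu(A)$, the $\theta(A)$ are independent and $\theta(A)\sim\mathrm{Beta}\bigl(\theta_0(A)\nu(A),(1-\theta_0(A))\nu(A)\bigr)$, which means the point mass at $\theta_0(A)$ if $\nu(A)=\infty$ or $\theta_0(A)\in\{0,1\}$. The Markov-APT is *stochastically increasing* if $\gamma_{i,i'}(A)=0$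 whenever $i>i'$, for all nodes $A\ne\Omega$. **Theorem (Absolute continuity).** Suppose that $Q$ has a stochastically increasing Markov-APT distribution for which $F^{I}_{\nu(A)}$ is the point mass at $\infty$ for every node $A$, and that there exist $\delta>0$ and $K$ such that for every $k\ge K$ and every node $A$ of level $k$, $$\gamma_{i,I}(A)>\delta\qquad\text{for } i=1,2,\dots,I-1 .$$ Then with probability $1$, $Q\ll Q_0$. In particular, if $Q_0\ll\mu$, then $Q\ll\mu$ with probability $1$. -/

import Mathlib

open MeasureTheory ProbabilityTheory
open scoped ENNReal

universe u

/-- A node of the infinite binary tree, written as the word of left (`false`) and right (`true`)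
turns that leads to it, last turn first. The root is `[]`, the children of `A` are `false :: A`
and `true :: A`, the parent of a node `A ≠ []` is `A.tail`, and its level is `A.length`. -/
abbrev Node : Type := List Bool

/-- A sequence of nested dyadic partitions of `Ω` that generates the `σ`-algebra. Cells may be
empty; on a finite space, a cell without proper children is split into itself and `∅`. -/
structure PartitionTree (Ω : Type u) [m : MeasurableSpace Ω] where
  cell : Node → Set Ω
  cell_root : cell [] = Set.univ
  cell_eq_union : ∀ A, cell A = cell (false :: A) ∪ cell (true :: A)
  cell_disjoint : ∀ A, Disjoint (cell (false :: A)) (cell (true :: A))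
  generates : m = MeasurableSpace.generateFrom (Set.range cell)

theorem PartitionTree.measurableSet_cell {Ω : Type u} [m : MeasurableSpace Ω]
    (T : PartitionTree Ω) (A : Node) : MeasurableSet (T.cell A) := by
  have h : MeasurableSet[MeasurableSpace.generateFrom (Set.range T.cell)] (T.cell A) :=
    MeasurableSpace.measurableSet_generateFrom ⟨A, rfl⟩
  exact T.generates.ge _ h

/-- The Markov tree and shrinkage hyperparameters `(γ, F)` of a Markov-APT with `I` shrinkage
states. The states are `Fin I`, the last one being `⊤`. -/
structure ShrinkageParams (I : ℕ) where
  /-- initial state probabilities at the root -/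
  init : PMF (Fin I)
  /-- `trans A i j` is the probability that `A` is in state `j` given that its parent is in state
  `i`. The value at the root, which has no parent, is never used. -/
  trans : Node → Fin I → PMF (Fin I)
  /-- `F A i` is the distribution of the shrinkage parameter on `A` in state `i`. -/
  F : Node → Fin I → Measure ℝ≥0∞
  isProbabilityMeasure_F : ∀ A i, IsProbabilityMeasure (F A i)
  /-- the distributions live on `(0, ∞]` -/
  F_zero : ∀ A i, F A i {0} = 0
  /-- the components are in increasing stochastic order -/
  F_mono : ∀ A i j, i ≤ j → ∀ t : ℝ≥0∞, F A i (Set.Ioi t) ≤ F A j (Set.Ioi t)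

/-- All transition matrices are upper triangular. -/
def ShrinkageParams.StochasticallyIncreasing {I : ℕ} (φ : ShrinkageParams I) : Prop :=
  ∀ A : Node, A ≠ [] → ∀ i j : Fin I, j < i → φ.trans A i j = 0

/-- The law `Beta(θ₀ ν, (1 - θ₀) ν)` with mean `θ₀ ∈ [0, 1]` and precision `ν ∈ (0, ∞]`. It is the
point mass at `θ₀` if `ν = ∞`, or if one of the two Beta parameters is zero. -/
noncomputable def betaMeanPrec (θ₀ : ℝ) (ν : ℝ≥0∞) : Measure ℝ :=
  open Classical in
  if ν = ∞ ∨ θ₀ = 0 ∨ θ₀ = 1 then Measure.dirac θ₀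
  else betaMeasure (θ₀ * ν.toReal) ((1 - θ₀) * ν.toReal)

section Model

variable {Ω : Type u} [MeasurableSpace Ω]

/-- The probability assignment coefficients `θ₀(A) = Q₀(A_l) / Q₀(A)` of a distribution `Q₀`,
with value `0` if `Q₀(A) = 0`. -/
noncomputable def PartitionTree.pac (T : PartitionTree Ω) (Q₀ : ProbabilityMeasure Ω)
    (A : Node) : ℝ :=
  ((Q₀ : Measure Ω) (T.cell (false :: A)) / (Q₀ : Measure Ω) (T.cell A)).toReal

variable {S : Type*} [MeasurableSpace S] {I : ℕ}

/-- `C` is a Markov tree with initial probabilities `φ.init` and transition probabilities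
`φ.trans`: its joint law on every finite subtree `t` containing the root factorizes along `t`. -/
def IsMarkovTree (φ : ShrinkageParams I) (P : Measure S) (C : S → Node → Fin I) : Prop :=
  ∀ t : Finset Node, [] ∈ t → (∀ A ∈ t, A.tail ∈ t) → ∀ c : Node → Fin I,
    P {s | ∀ A ∈ t, C s A = c A} =
      φ.init (c []) * ∏ A ∈ t.erase [], φ.trans A (c A.tail) (c A)

/-- The hierarchical model: the random variables `C`, `ν`, `θ`, `Q` on the probability space
`(S, P)` are the shrinkage states, the shrinkage parameters, the probability assignment
coefficients, and a random probability measure with these coefficients. -/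
structure IsMarkovAPTModel (T : PartitionTree Ω) (φ : ShrinkageParams I)
    (Q₀ : ProbabilityMeasure Ω) (P : Measure S) (C : S → Node → Fin I) (ν : S → Node → ℝ≥0∞)
    (θ : S → Node → ℝ) (Q : S → ProbabilityMeasure Ω) : Prop where
  isProbabilityMeasure : IsProbabilityMeasure P
  measurable_C : Measurable C
  measurable_ν : Measurable ν
  measurable_θ : Measurable θ
  /-- `C ∼ MT(γ)` -/
  states : IsMarkovTree φ P C
  /-- given `C`, the `ν(A)` are independent with `ν(A) ∼ F^i_{ν(A)}` on `C(A) = i` -/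
  shrinkage : ∀ (t : Finset Node) (E : Set (Node → Fin I)) (B : Node → Set ℝ≥0∞),
    MeasurableSet E → (∀ A, MeasurableSet (B A)) →
    P {s | C s ∈ E ∧ ∀ A ∈ t, ν s A ∈ B A} =
      ∫⁻ s in {s | C s ∈ E}, ∏ A ∈ t, φ.F A (C s A) (B A) ∂P
  /-- given `(C, ν)`, the `θ(A)` are independent with
  `θ(A) ∼ Beta(θ₀(A) ν(A), (1 - θ₀(A)) ν(A))` -/
  coefficients : ∀ (t : Finset Node) (E : Set ((Node → Fin I) × (Node → ℝ≥0∞)))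
    (D : Node → Set ℝ), MeasurableSet E → (∀ A, MeasurableSet (D A)) →
    P {s | (C s, ν s) ∈ E ∧ ∀ A ∈ t, θ s A ∈ D A} =
      ∫⁻ s in {s | (C s, ν s) ∈ E}, ∏ A ∈ t, betaMeanPrec (T.pac Q₀ A) (ν s A) (D A) ∂P
  /-- almost surely, `Q(A_l) = Q(A) θ(A)` and `Q(A_r) = Q(A) (1 - θ(A))` for every node `A` -/
  split : ∀ᵐ s ∂P, ∀ A : Node,
    (Q s : Measure Ω) (T.cell (false :: A)) =
      (Q s : Measure Ω) (T.cell A) * ENNReal.ofReal (θ s A) ∧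
    (Q s : Measure Ω) (T.cell (true :: A)) =
      (Q s : Measure Ω) (T.cell A) * ENNReal.ofReal (1 - θ s A)

/-- The law `π` on probability measures is the Markov-APT distribution with partition tree `T` and
hyperparameters `(γ, F, Q₀)`. -/
def IsMarkovAPT (T : PartitionTree Ω) (φ : ShrinkageParams I) (Q₀ : ProbabilityMeasure Ω)
    (π : Measure (ProbabilityMeasure Ω)) : Prop :=
  ∃ (S : Type u) (_ : MeasurableSpace S) (P : Measure S) (C : S → Node → Fin I)
    (ν : S → Node → ℝ≥0∞) (θ : S → Node → ℝ) (Q : S → ProbabilityMeasure Ω),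
    IsMarkovAPTModel T φ Q₀ P C ν θ Q ∧ HasLaw Q π P

end Model

/-! ### The Beta distribution with given mean and precision -/

/-! Call a node complete if its state is `⊤`. Below a complete node every state is again `⊤`, since
the transitions are upper triangular. There the precision is `∞` and each split is exactly that of
`Q₀`, so on a complete cell `Q` is proportional to `Q₀` (`restrict_cell_absolutelyContinuous`). A
`Q₀`-null set therefore carries `Q`-mass only on incomplete cells, whatever the level at which one
looks.

The mass of the incomplete cells is controlled in mean. Each Beta law has mean `θ₀(A)`, so
conditionally on the states the expected mass of a node is `Q₀(A)` (`setLIntegral_splitMass`). A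
node of level `k` is incomplete with probability at most `(1 - δ) ^ (k - K)`
(`measure_ne_top_le_pow`). Summing the products over level `k` bounds the expected incomplete mass
by `(1 - δ) ^ (k - K)`. Its infimum over `k` thus has expectation zero, hence vanishes almost
surely, and this single event serves all `Q₀`-null sets at once. -/

theorem measurable_indicator_Gamma : Measurable ((Set.Ioi (0 : ℝ)).indicator Real.Gamma) := by
  have h : ContinuousOn Real.Gamma (Set.Ioi 0) := fun x hx =>
    (Real.differentiableAt_Gamma fun m => by
      have : (0 : ℝ) ≤ m := m.cast_nonneg
      have : 0 < x := hx
      linarith).continuousAt.continuousWithinAt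
  have := h.measurable_piecewise (g := (0 : ℝ → ℝ)) continuousOn_const measurableSet_Ioi
  rwa [Set.piecewise_eq_indicator] at this

theorem indicator_Gamma_of_nonneg {x : ℝ} (hx : 0 ≤ x) :
    (Set.Ioi (0 : ℝ)).indicator Real.Gamma x = Real.Gamma x := by
  rcases hx.eq_or_lt with rfl | hx
  · simp [Real.Gamma_zero]
  · exact Set.indicator_of_mem (Set.mem_Ioi.2 hx) _

/-- Both Beta parameters are nonnegative, so `Real.Gamma` may be replaced by its restriction to the
positive axis, where it is continuous. At `0` the two agree because `Real.Gamma 0 = 0` by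
convention. -/
theorem measurable_betaPDF_mean_prec {θ₀ : ℝ} (h₀ : 0 ≤ θ₀) (h₁ : θ₀ ≤ 1) :
    Measurable fun p : ℝ≥0∞ × ℝ =>
      betaPDF (θ₀ * p.1.toReal) ((1 - θ₀) * p.1.toReal) p.2 := by
  have hG := measurable_indicator_Gamma
  set G := (Set.Ioi (0 : ℝ)).indicator Real.Gamma with hGdef
  have key : (fun p : ℝ≥0∞ × ℝ => betaPDF (θ₀ * p.1.toReal) ((1 - θ₀) * p.1.toReal) p.2) =
      fun p => ENNReal.ofReal (if 0 < p.2 ∧ p.2 < 1 then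
        (1 / (G (θ₀ * p.1.toReal) * G ((1 - θ₀) * p.1.toReal) /
          G (θ₀ * p.1.toReal + (1 - θ₀) * p.1.toReal))) *
          p.2 ^ (θ₀ * p.1.toReal - 1) * (1 - p.2) ^ ((1 - θ₀) * p.1.toReal - 1) else 0) := by
    funext p
    have ha : 0 ≤ θ₀ * p.1.toReal := mul_nonneg h₀ ENNReal.toReal_nonneg
    have hb : 0 ≤ (1 - θ₀) * p.1.toReal := mul_nonneg (by linarith) ENNReal.toReal_nonneg
    rw [hGdef, indicator_Gamma_of_nonneg ha, indicator_Gamma_of_nonneg hb,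
      indicator_Gamma_of_nonneg (add_nonneg ha hb)]
    rfl
  rw [key]
  refine ENNReal.measurable_ofReal.comp (Measurable.ite ?_ ?_ measurable_const)
  · exact (measurableSet_lt measurable_const measurable_snd).inter
      (measurableSet_lt measurable_snd measurable_const)
  · fun_prop

theorem measurable_betaMeanPrec {θ₀ : ℝ} (h₀ : 0 ≤ θ₀) (h₁ : θ₀ ≤ 1) :
    Measurable (betaMeanPrec θ₀) := by
  classical
  refine Measure.measurable_of_measurable_coe _ fun D hD => ?_
  have : (fun ν => betaMeanPrec θ₀ ν D) = fun ν : ℝ≥0∞ =>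
      if ν = ∞ ∨ θ₀ = 0 ∨ θ₀ = 1 then Measure.dirac θ₀ D
      else ∫⁻ x in D, betaPDF (θ₀ * ν.toReal) ((1 - θ₀) * ν.toReal) x := by
    funext ν
    unfold betaMeanPrec
    split_ifs
    · rfl
    · rw [betaMeasure, withDensity_apply _ hD]
  rw [this]
  refine Measurable.ite ?_ measurable_const ?_
  · exact (measurableSet_singleton ∞).union (MeasurableSet.const _)
  · exact (measurable_betaPDF_mean_prec h₀ h₁).lintegral_prod_right'

theorem measurable_betaPDF (a b : ℝ) : Measurable (betaPDF a b) :=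
  ENNReal.measurable_ofReal.comp (measurable_betaPDFReal a b)

theorem beta_add_one_left {a b : ℝ} (ha : 0 < a) (hb : 0 < b) :
    beta (a + 1) b = beta a b * (a / (a + b)) := by
  have h := (Real.Gamma_pos_of_pos (add_pos ha hb)).ne'
  rw [beta, beta, Real.Gamma_add_one ha.ne', show a + 1 + b = a + b + 1 by ring,
    Real.Gamma_add_one (add_pos ha hb).ne']
  field_simp

theorem beta_add_one_right {a b : ℝ} (ha : 0 < a) (hb : 0 < b) :
    beta a (b + 1) = beta a b * (b / (a + b)) := by
  have h := (Real.Gamma_pos_of_pos (add_pos ha hb)).ne'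
  rw [beta, beta, Real.Gamma_add_one hb.ne', ← add_assoc,
    Real.Gamma_add_one (add_pos ha hb).ne']
  field_simp

/-- Multiplying the Beta(a, b) density by `x` gives `a / (a + b)` times the Beta(a + 1, b) density,
which has total mass one. -/
theorem lintegral_ofReal_betaMeasure {a b : ℝ} (ha : 0 < a) (hb : 0 < b) :
    ∫⁻ x, ENNReal.ofReal x ∂betaMeasure a b = ENNReal.ofReal (a / (a + b)) := by
  have hab := add_pos ha hb
  rw [betaMeasure, lintegral_withDensity_eq_lintegral_mul _ (measurable_betaPDF a b)
    ENNReal.measurable_ofReal]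
  have : ∀ x, (betaPDF a b * ENNReal.ofReal) x =
      ENNReal.ofReal (a / (a + b)) * betaPDF (a + 1) b x := by
    intro x
    by_cases hx : 0 < x ∧ x < 1
    · have h1 := (beta_pos ha hb).ne'
      simp only [Pi.mul_apply]
      rw [betaPDF_of_pos_lt_one hx.1 hx.2, betaPDF_of_pos_lt_one hx.1 hx.2,
        ← ENNReal.ofReal_mul' hx.1.le, ← ENNReal.ofReal_mul (by positivity),
        beta_add_one_left ha hb, add_sub_cancel_right]
      have h2 : x ^ a = x ^ (a - 1) * x := by
        rw [← Real.rpow_add_one hx.1.ne', sub_add_cancel]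
      rw [h2]
      congr 1
      field_simp
    · simp [betaPDF_eq, hx]
  simp_rw [this]
  rw [lintegral_const_mul _ (measurable_betaPDF _ _),
    lintegral_betaPDF_eq_one (by linarith) hb, mul_one]

theorem lintegral_ofReal_one_sub_betaMeasure {a b : ℝ} (ha : 0 < a) (hb : 0 < b) :
    ∫⁻ x, ENNReal.ofReal (1 - x) ∂betaMeasure a b = ENNReal.ofReal (b / (a + b)) := by
  have hab := add_pos ha hb
  rw [betaMeasure, lintegral_withDensity_eq_lintegral_mul _ (measurable_betaPDF a b)
    (by fun_prop)]
  have : ∀ x, (betaPDF a b * fun x => ENNReal.ofReal (1 - x)) x =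
      ENNReal.ofReal (b / (a + b)) * betaPDF a (b + 1) x := by
    intro x
    by_cases hx : 0 < x ∧ x < 1
    · have h1 := (beta_pos ha hb).ne'
      have hx' : 0 < 1 - x := by linarith [hx.2]
      simp only [Pi.mul_apply]
      rw [betaPDF_of_pos_lt_one hx.1 hx.2, betaPDF_of_pos_lt_one hx.1 hx.2,
        ← ENNReal.ofReal_mul' hx'.le, ← ENNReal.ofReal_mul (by positivity),
        beta_add_one_right ha hb, add_sub_cancel_right]
      have h2 : (1 - x) ^ b = (1 - x) ^ (b - 1) * (1 - x) := by
        rw [← Real.rpow_add_one hx'.ne', sub_add_cancel]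
      rw [h2]
      congr 1
      field_simp
    · simp [betaPDF_eq, hx]
  simp_rw [this]
  rw [lintegral_const_mul _ (measurable_betaPDF _ _),
    lintegral_betaPDF_eq_one ha (by linarith), mul_one]

/-- The proportion of mass that goes to the right (`b = true`) or left (`b = false`) child. -/
noncomputable def splitFactor (b : Bool) (x : ℝ) : ℝ≥0∞ := ENNReal.ofReal (bif b then 1 - x else x)

theorem measurable_splitFactor (b : Bool) : Measurable (splitFactor b) := by
  cases b
  · exact ENNReal.measurable_ofReal
  · exact ENNReal.measurable_ofReal.comp (measurable_const.sub measurable_id)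

/-- Outside the point-mass cases, `ν ≠ 0` makes both Beta parameters positive; their sum is the
precision, which cancels from the mean. -/
theorem lintegral_splitFactor_betaMeanPrec {θ₀ : ℝ} (h₀ : 0 ≤ θ₀) (h₁ : θ₀ ≤ 1) {ν : ℝ≥0∞}
    (hν : ν ≠ 0) (b : Bool) :
    ∫⁻ x, splitFactor b x ∂betaMeanPrec θ₀ ν = splitFactor b θ₀ := by
  classical
  unfold betaMeanPrec
  split_ifs with h
  · exact lintegral_dirac' _ (measurable_splitFactor b)
  · push Not at h
    have hp : 0 < ν.toReal := ENNReal.toReal_pos hν h.1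
    have h0 : 0 < θ₀ := lt_of_le_of_ne h₀ h.2.1.symm
    have h1 : 0 < 1 - θ₀ := sub_pos.2 (lt_of_le_of_ne h₁ h.2.2)
    have hs : θ₀ * ν.toReal + (1 - θ₀) * ν.toReal = ν.toReal := by ring
    cases b
    · simp only [splitFactor, cond_false]
      rw [lintegral_ofReal_betaMeasure (by positivity) (by positivity), hs,
        mul_div_cancel_right₀ _ hp.ne']
    · simp only [splitFactor, cond_true]
      rw [lintegral_ofReal_one_sub_betaMeasure (by positivity) (by positivity), hs,
        mul_div_cancel_right₀ _ hp.ne']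

/-! ### Conditional independence, from rectangles to products of functions -/

/-- Indicators are exchanged for general functions one index at a time. With the other factors
absorbed into densities, each side is the mass that a measure gives to the set `D` at index `j`; two
measures that agree on all `D` have the same integrals. -/
theorem lintegral_prod_eq_of_rectangles {S ι X : Type*} [MeasurableSpace S] [MeasurableSpace X]
    (P : Measure S) (t : Finset ι) {θ : S → ι → X} (hθ : ∀ i, Measurable fun s => θ s i)
    {κ : ι → S → Measure X} (hκ : ∀ i, Measurable (κ i))
    (h : ∀ D : ι → Set X, (∀ i, MeasurableSet (D i)) →
      P {s | ∀ i ∈ t, θ s i ∈ D i} = ∫⁻ s, ∏ i ∈ t, κ i s (D i) ∂P)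
    {f : ι → X → ℝ≥0∞} (hf : ∀ i, Measurable (f i)) :
    ∫⁻ s, ∏ i ∈ t, f i (θ s i) ∂P = ∫⁻ s, ∏ i ∈ t, ∫⁻ x, f i x ∂κ i s ∂P := by
  classical
  have hint : ∀ {g : ι → X → ℝ≥0∞}, (∀ i, Measurable (g i)) → ∀ i,
      Measurable fun s => ∫⁻ x, g i x ∂κ i s :=
    fun hg i => (Measure.measurable_lintegral (hg i)).comp (hκ i)
  -- The set `r` holds the indices already freed; off `r` the factors are still indicators.
  suffices H : ∀ r ⊆ t, ∀ g : ι → X → ℝ≥0∞, (∀ i, Measurable (g i)) →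
      (∀ i ∉ r, ∃ D, MeasurableSet D ∧ g i = D.indicator 1) →
      ∫⁻ s, ∏ i ∈ t, g i (θ s i) ∂P = ∫⁻ s, ∏ i ∈ t, ∫⁻ x, g i x ∂κ i s ∂P by
    let g : ι → X → ℝ≥0∞ := fun i => if i ∈ t then f i else Set.univ.indicator 1
    have hg : ∀ i ∈ t, g i = f i := fun i hi => if_pos hi
    have := H t subset_rfl g
      (fun i => by
        by_cases hi : i ∈ t
        · simpa [g, hi] using hf i
        · simpa [g, hi] using measurable_one)
      fun i hi => ⟨Set.univ, .univ, if_neg hi⟩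
    have e1 : ∀ s, ∏ i ∈ t, g i (θ s i) = ∏ i ∈ t, f i (θ s i) :=
      fun s => Finset.prod_congr rfl fun i hi => by rw [hg i hi]
    have e2 : ∀ s, ∏ i ∈ t, ∫⁻ x, g i x ∂κ i s = ∏ i ∈ t, ∫⁻ x, f i x ∂κ i s :=
      fun s => Finset.prod_congr rfl fun i hi => by rw [hg i hi]
    simpa only [e1, e2] using this
  intro r
  induction r using Finset.induction_on with
  | empty =>
    intro _ g _ hD
    choose D hDm hgD using fun i => hD i (Finset.notMem_empty i)
    have e1 : ∀ s, ∏ i ∈ t, g i (θ s i) =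
        Set.indicator {s | ∀ i ∈ t, θ s i ∈ D i} (fun _ => (1 : ℝ≥0∞)) s := by
      intro s
      by_cases hs : ∀ i ∈ t, θ s i ∈ D i
      · rw [Set.indicator_of_mem (by exact hs)]
        exact Finset.prod_eq_one fun i hi => by rw [hgD, Set.indicator_of_mem (hs i hi)]; rfl
      · rw [Set.indicator_of_notMem (by exact hs)]
        push Not at hs
        obtain ⟨i, hi, his⟩ := hs
        exact Finset.prod_eq_zero hi (by rw [hgD, Set.indicator_of_notMem his])
    have hms : MeasurableSet {s | ∀ i ∈ t, θ s i ∈ D i} := by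
      have : {s | ∀ i ∈ t, θ s i ∈ D i} = ⋂ i ∈ t, (fun s => θ s i) ⁻¹' D i := by ext; simp
      rw [this]
      exact Finset.measurableSet_biInter _ fun i _ => hθ i (hDm i)
    simp_rw [e1, lintegral_indicator_const hms, one_mul, h D hDm]
    simp_rw [hgD, lintegral_indicator_one (hDm _)]
  | insert j r hj ih =>
    intro hr g hg hD
    have hjt : j ∈ t := hr (Finset.mem_insert_self j r)
    have hW : Measurable fun s => ∏ i ∈ t.erase j, g i (θ s i) :=
      Finset.measurable_fun_prod _ fun i _ => (hg i).comp (hθ i)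
    have hW' : Measurable fun s => ∏ i ∈ t.erase j, ∫⁻ x, g i x ∂κ i s :=
      Finset.measurable_fun_prod _ fun i _ => hint hg i
    have hm : (P.withDensity fun s => ∏ i ∈ t.erase j, g i (θ s i)).map (fun s => θ s j) =
        (P.withDensity fun s => ∏ i ∈ t.erase j, ∫⁻ x, g i x ∂κ i s).bind (κ j) := by
      ext D hDm
      have hind : Measurable (D.indicator (1 : X → ℝ≥0∞)) := measurable_one.indicator hDm
      have := ih ((Finset.subset_insert j r).trans hr) (Function.update g j (D.indicator 1))
        (fun i => by
          by_cases hi : i = j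
          · subst hi; simpa using hind
          · simpa [hi] using hg i)
        (fun i hi => by
          by_cases hij : i = j
          · subst hij; exact ⟨D, hDm, by simp⟩
          · simpa [hij] using hD i (by simp [hij, hi]))
      have e1 : ∀ s, ∏ i ∈ t, Function.update g j (D.indicator 1) i (θ s i) =
          (∏ i ∈ t.erase j, g i (θ s i)) * D.indicator 1 (θ s j) := fun s => by
        rw [← Finset.prod_erase_mul _ _ hjt, Function.update_self]
        congr 1
        exact Finset.prod_congr rfl fun i hi => by
          rw [Function.update_of_ne (Finset.ne_of_mem_erase hi)]
      have e2 : ∀ s, ∏ i ∈ t, ∫⁻ x, Function.update g j (D.indicator 1) i x ∂κ i s =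
          (∏ i ∈ t.erase j, ∫⁻ x, g i x ∂κ i s) * κ j s D := fun s => by
        rw [← Finset.prod_erase_mul _ _ hjt, Function.update_self, lintegral_indicator_one hDm]
        congr 1
        exact Finset.prod_congr rfl fun i hi => by
          rw [Function.update_of_ne (Finset.ne_of_mem_erase hi)]
      simp_rw [e1, e2] at this
      rw [Measure.bind_apply hDm (hκ j).aemeasurable,
        lintegral_withDensity_eq_lintegral_mul _ hW'
          (g := fun s => κ j s D) ((Measure.measurable_coe hDm).comp (hκ j)),
        ← lintegral_indicator_one hDm, lintegral_map hind (hθ j),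
        lintegral_withDensity_eq_lintegral_mul _ hW (g := fun s => D.indicator 1 (θ s j))
          (hind.comp (hθ j))]
      exact this
    have := congrArg (fun m => ∫⁻ x, g j x ∂m) hm
    rw [lintegral_map (hg j) (hθ j), Measure.lintegral_bind (hκ j).aemeasurable
      (hg j).aemeasurable, lintegral_withDensity_eq_lintegral_mul _ hW (g := fun s => g j (θ s j))
        ((hg j).comp (hθ j)),
      lintegral_withDensity_eq_lintegral_mul _ hW' (hint hg j)] at this
    simpa only [Pi.mul_apply, Finset.prod_erase_mul _ _ hjt] using this

/-! ### Partition trees -/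

namespace PartitionTree

variable {Ω : Type u} [m : MeasurableSpace Ω] (T : PartitionTree Ω)

theorem cell_cons_subset (b : Bool) (A : Node) : T.cell (b :: A) ⊆ T.cell A := by
  rw [T.cell_eq_union A]
  cases b
  · exact Set.subset_union_left
  · exact Set.subset_union_right

theorem cell_append_subset (L A : Node) : T.cell (L ++ A) ⊆ T.cell A := by
  induction L with
  | nil => exact subset_rfl
  | cons b L ih => exact (T.cell_cons_subset b (L ++ A)).trans ih

theorem cell_subset_of_suffix {A B : Node} (h : A <:+ B) : T.cell B ⊆ T.cell A := by
  obtain ⟨L, rfl⟩ := h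
  exact T.cell_append_subset L A

theorem disjoint_cell_cons {b b' : Bool} (h : b ≠ b') (A : Node) :
    Disjoint (T.cell (b :: A)) (T.cell (b' :: A)) := by
  cases b <;> cases b' <;> simp_all [T.cell_disjoint A, (T.cell_disjoint A).symm]

theorem suffix_or_suffix_or_disjoint (A B : Node) :
    A <:+ B ∨ B <:+ A ∨ Disjoint (T.cell A) (T.cell B) := by
  induction A with
  | nil => exact Or.inl List.nil_suffix
  | cons b A ih =>
    rcases ih with ⟨L, rfl⟩ | h | h
    -- The last letter of `L` is the first turn taken below `A` on the way to the other node; it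
    -- decides between a descendant of `b :: A` and a disjoint cell.
    · rcases L.eq_nil_or_concat with rfl | ⟨L, b', rfl⟩
      · exact Or.inr (Or.inl (List.suffix_cons b A))
      · by_cases hb : b = b'
        · subst hb
          exact Or.inl ⟨L, by simp⟩
        · refine Or.inr (Or.inr ((T.disjoint_cell_cons hb A).mono_right ?_))
          simpa using T.cell_append_subset L (b' :: A)
    · exact Or.inr (Or.inl (h.trans (List.suffix_cons b A)))
    · exact Or.inr (Or.inr (h.mono_left (T.cell_cons_subset b A)))

theorem isPiSystem_range_cell : IsPiSystem (Set.range T.cell) := by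
  rintro _ ⟨A, rfl⟩ _ ⟨B, rfl⟩ hne
  rcases T.suffix_or_suffix_or_disjoint A B with h | h | h
  · exact ⟨B, (Set.inter_eq_right.2 (T.cell_subset_of_suffix h)).symm⟩
  · exact ⟨A, (Set.inter_eq_left.2 (T.cell_subset_of_suffix h)).symm⟩
  · exact absurd (Set.disjoint_iff_inter_eq_empty.1 h) hne.ne_empty

theorem countablyGenerated (T : PartitionTree Ω) : MeasurableSpace.CountablyGenerated Ω :=
  ⟨⟨Set.range T.cell, Set.countable_range _, T.generates⟩⟩

theorem pairwise_disjoint_cell (k : ℕ) :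
    Pairwise (Function.onFun Disjoint fun A : {A : Node // A.length = k} => T.cell A.1) := by
  rintro ⟨A, hA⟩ ⟨B, hB⟩ hne
  have hne' : A ≠ B := fun h => hne (Subtype.ext h)
  rcases T.suffix_or_suffix_or_disjoint A B with h | h | h
  · exact absurd (h.eq_of_length (hA.trans hB.symm)) hne'
  · exact absurd (h.eq_of_length (hB.trans hA.symm)).symm hne'
  · exact h

theorem iUnion_cell_level (k : ℕ) : ⋃ A : {A : Node // A.length = k}, T.cell A.1 = Set.univ := by
  refine Set.eq_univ_of_forall fun x => Set.mem_iUnion.2 ?_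
  induction k with
  | zero => exact ⟨⟨[], rfl⟩, by simp [T.cell_root]⟩
  | succ k ih =>
    obtain ⟨⟨A, hA⟩, hx⟩ := ih
    rw [T.cell_eq_union A] at hx
    rcases hx with hx | hx
    · exact ⟨⟨false :: A, by simp [hA]⟩, hx⟩
    · exact ⟨⟨true :: A, by simp [hA]⟩, hx⟩

theorem measure_cell_eq_add (q : Measure Ω) (A : Node) :
    q (T.cell A) = q (T.cell (false :: A)) + q (T.cell (true :: A)) := by
  conv_lhs => rw [T.cell_eq_union A]
  exact measure_union (T.cell_disjoint A) (T.measurableSet_cell _)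

theorem pac_nonneg (Q₀ : ProbabilityMeasure Ω) (A : Node) : 0 ≤ T.pac Q₀ A :=
  ENNReal.toReal_nonneg

theorem pac_le_one (Q₀ : ProbabilityMeasure Ω) (A : Node) : T.pac Q₀ A ≤ 1 :=
  ENNReal.toReal_le_of_le_ofReal zero_le_one <| by
    rw [ENNReal.ofReal_one]
    refine ENNReal.div_le_of_le_mul ?_
    rw [one_mul]
    exact measure_mono (T.cell_cons_subset false A)

theorem measure_cell_false (Q₀ : ProbabilityMeasure Ω) (A : Node) :
    (Q₀ : Measure Ω) (T.cell (false :: A)) =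
      (Q₀ : Measure Ω) (T.cell A) * ENNReal.ofReal (T.pac Q₀ A) := by
  have hle : (Q₀ : Measure Ω) (T.cell (false :: A)) ≤ (Q₀ : Measure Ω) (T.cell A) :=
    measure_mono (T.cell_cons_subset false A)
  by_cases h0 : (Q₀ : Measure Ω) (T.cell A) = 0
  · rw [h0, zero_mul]
    exact le_antisymm (hle.trans h0.le) zero_le
  · rw [pac, ENNReal.ofReal_toReal (ENNReal.div_ne_top (measure_ne_top _ _) h0),
      ENNReal.mul_div_cancel h0 (measure_ne_top _ _)]

theorem measure_cell_true (Q₀ : ProbabilityMeasure Ω) (A : Node) :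
    (Q₀ : Measure Ω) (T.cell (true :: A)) =
      (Q₀ : Measure Ω) (T.cell A) * ENNReal.ofReal (1 - T.pac Q₀ A) := by
  have h := T.measure_cell_eq_add (Q₀ : Measure Ω) A
  have h1 : (Q₀ : Measure Ω) (T.cell A) * ENNReal.ofReal (T.pac Q₀ A) +
      (Q₀ : Measure Ω) (T.cell A) * ENNReal.ofReal (1 - T.pac Q₀ A) =
      (Q₀ : Measure Ω) (T.cell A) := by
    rw [← mul_add, ← ENNReal.ofReal_add (T.pac_nonneg Q₀ A) (by linarith [T.pac_le_one Q₀ A])]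
    simp
  have h2 := h.symm.trans h1.symm
  rw [T.measure_cell_false Q₀ A] at h2
  refine (ENNReal.add_right_inj ?_).1 h2
  rw [← T.measure_cell_false]
  exact measure_ne_top _ _

/-- If `q` splits the mass of every descendant of `A` as `Q₀` does, then `q` is proportional to `Q₀`
on `A`. -/
theorem restrict_cell_absolutelyContinuous (Q₀ q : ProbabilityMeasure Ω) (A : Node)
    (h0 : (Q₀ : Measure Ω) (T.cell A) = 0 → (q : Measure Ω) (T.cell A) = 0)
    (hq : ∀ L : Node, (q : Measure Ω) (T.cell (false :: (L ++ A))) =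
        (q : Measure Ω) (T.cell (L ++ A)) * ENNReal.ofReal (T.pac Q₀ (L ++ A)) ∧
      (q : Measure Ω) (T.cell (true :: (L ++ A))) =
        (q : Measure Ω) (T.cell (L ++ A)) * ENNReal.ofReal (1 - T.pac Q₀ (L ++ A))) :
    (q : Measure Ω).restrict (T.cell A) ≪ (Q₀ : Measure Ω) := by
  set q' : Measure Ω := (q : Measure Ω)
  set Q : Measure Ω := (Q₀ : Measure Ω) with hQ
  by_cases hA : Q (T.cell A) = 0
  · rw [Measure.restrict_eq_zero.2 (h0 hA)]
    exact Measure.AbsolutelyContinuous.zero _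
  -- Proportionality is cross-multiplied, so that no division is needed; it propagates because `q`
  -- and `Q₀` use the same split factors.
  have hdesc : ∀ L : Node, Q (T.cell A) * q' (T.cell (L ++ A)) =
      q' (T.cell A) * Q (T.cell (L ++ A)) := by
    intro L
    induction L with
    | nil => exact mul_comm _ _
    | cons b L ih =>
      cases b
      · rw [List.cons_append, (hq L).1, hQ, T.measure_cell_false, ← hQ, ← mul_assoc, ih,
          mul_assoc]
      · rw [List.cons_append, (hq L).2, hQ, T.measure_cell_true, ← hQ, ← mul_assoc, ih,
          mul_assoc]
  have heq : Q (T.cell A) • q'.restrict (T.cell A) = q' (T.cell A) • Q.restrict (T.cell A) := by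
    have : IsFiniteMeasure (Q (T.cell A) • q'.restrict (T.cell A)) :=
      Measure.smul_finite _ (measure_ne_top _ _)
    refine ext_of_generate_finite _ T.generates T.isPiSystem_range_cell ?_ ?_
    · rintro _ ⟨B, rfl⟩
      simp only [Measure.smul_apply, smul_eq_mul,
        Measure.restrict_apply (T.measurableSet_cell B)]
      rcases T.suffix_or_suffix_or_disjoint A B with ⟨L, rfl⟩ | h | h
      · rw [Set.inter_eq_left.2 (T.cell_append_subset L A)]
        exact hdesc L
      · rw [Set.inter_eq_right.2 (T.cell_subset_of_suffix h)]
        exact mul_comm _ _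
      · rw [Set.disjoint_iff_inter_eq_empty.1 h.symm]
        simp
    · simp [mul_comm]
  intro N hN
  have h1 := congrArg (fun μ : Measure Ω => μ N) heq
  have h2 : Q.restrict (T.cell A) N = 0 := Measure.absolutelyContinuous_of_le
    Measure.restrict_le_self hN
  simp only [Measure.smul_apply, smul_eq_mul, h2, mul_zero, mul_eq_zero] at h1
  exact h1.resolve_left hA

/-- A measure is absolutely continuous if it is so on a set of cells which, as the level increases,
carries almost all the mass. -/
theorem absolutelyContinuous_of_cells (q Q : Measure Ω) (G : Set Node)
    (hG : ∀ A ∈ G, q.restrict (T.cell A) ≪ Q)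
    (hinf : ⨅ k : ℕ, ∑' A : {A : Node // A.length = k},
      Gᶜ.indicator (fun A => q (T.cell A)) A.1 = 0) :
    q ≪ Q := by
  intro N hN
  rw [← nonpos_iff_eq_zero, ← hinf]
  refine le_iInf fun k => ?_
  calc q N = q (⋃ A : {A : Node // A.length = k}, N ∩ T.cell A.1) := by
        rw [← Set.inter_iUnion, T.iUnion_cell_level, Set.inter_univ]
    _ ≤ ∑' A : {A : Node // A.length = k}, q (N ∩ T.cell A.1) := measure_iUnion_le _
    _ ≤ _ := ENNReal.tsum_le_tsum fun A => by
        by_cases hA : A.1 ∈ G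
        · have := hG A.1 hA hN
          rw [Measure.restrict_apply' (T.measurableSet_cell A.1)] at this
          rw [this]
          exact zero_le
        · rw [Set.indicator_of_mem (by exact hA)]
          exact measure_mono Set.inter_subset_right

end PartitionTree

/-- Absolute continuity with respect to a fixed measure is a measurable property. -/
theorem measurableSet_absolutelyContinuous_const {Ω : Type u} [MeasurableSpace Ω]
    [MeasurableSpace.CountablyGenerated Ω] (Q₀ : ProbabilityMeasure Ω) :
    MeasurableSet {q : ProbabilityMeasure Ω | (q : Measure Ω) ≪ (Q₀ : Measure Ω)} := by
  -- The inclusion of probability measures into measures is itself a kernel, which reduces the claim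
  -- to measurability of absolute continuity between two kernels.
  let κ : Kernel (ProbabilityMeasure Ω) Ω := ⟨fun q => (q : Measure Ω), measurable_subtype_coe⟩
  have : IsFiniteKernel κ := ⟨⟨1, ENNReal.one_lt_top, fun q => by
    change (q : Measure Ω) Set.univ ≤ 1
    simp⟩⟩
  exact Kernel.measurableSet_absolutelyContinuous κ (Kernel.const _ (Q₀ : Measure Ω))

/-! ### The Markov tree of states -/

section MarkovTree

variable {S : Type*} [MeasurableSpace S] {I : ℕ} {φ : ShrinkageParams I} {P : Measure S}
  {C : S → Node → Fin I}

/-- The ancestors of `A`, with `A` itself, form an admissible subtree, and adjoining the child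
multiplies each of its path probabilities by one transition factor. Summing over the states on the
path gives the claim. -/
theorem IsMarkovTree.measure_pair (h : IsMarkovTree φ P C) (hC : Measurable C) (b : Bool)
    (A : Node) (i j : Fin I) :
    P {s | C s A = i ∧ C s (b :: A) = j} = P {s | C s A = i} * φ.trans (b :: A) i j := by
  classical
  let t : Finset Node := A.tails.toFinset
  have ht : ∀ B, B ∈ t ↔ B <:+ A := fun B => by simp [t]
  have hroot : [] ∈ t := (ht _).2 List.nil_suffix
  have htail : ∀ B ∈ t, B.tail ∈ t := fun B hB =>
    (ht _).2 ((List.tail_suffix B).trans ((ht _).1 hB))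
  have hA : A ∈ t := (ht _).2 List.suffix_rfl
  have hbA : b :: A ∉ t := fun hm => by
    have := ((ht _).1 hm).length_le
    simp at this
  let X : S → (t → Fin I) := fun s B => C s B
  have hX : Measurable X := measurable_pi_lambda _ fun B => (measurable_pi_apply B.1).comp hC
  have hsum : ∀ E : Set S, MeasurableSet E → P E = ∑ x : t → Fin I, P (E ∩ X ⁻¹' {x}) := by
    intro E hE
    have := sum_measure_preimage_singleton (μ := P.restrict E) (Finset.univ : Finset (t → Fin I))
      (f := X) fun x _ => hX (measurableSet_singleton x)
    simp only [Finset.coe_univ, Set.preimage_univ, Measure.restrict_apply_univ] at this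
    rw [← this]
    refine Finset.sum_congr rfl fun x _ => ?_
    rw [Measure.restrict_apply (hX (measurableSet_singleton x)), Set.inter_comm]
  have hmC : ∀ B k, MeasurableSet {s | C s B = k} := fun B k =>
    ((measurable_pi_apply B).comp hC) (measurableSet_singleton k)
  rw [hsum _ (hmC A i), hsum {s | C s A = i ∧ C s (b :: A) = j} ((hmC A i).inter (hmC (b :: A) j)),
    Finset.sum_mul]
  refine Finset.sum_congr rfl fun x _ => ?_
  by_cases hx : x ⟨A, hA⟩ = i
  -- The value `j` off the path assigns the state `j` to the new child.
  · let c : Node → Fin I := fun B => if hB : B ∈ t then x ⟨B, hB⟩ else j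
    have hc : ∀ s, X s = x ↔ ∀ B ∈ t, C s B = c B := fun s => by
      constructor
      · intro hs B hB
        simp only [c, hB, dif_pos]
        exact congrFun hs ⟨B, hB⟩
      · intro hs
        funext B
        simpa [c, B.2] using hs B.1 B.2
    have hcA : c A = i := by simp [c, hA, hx]
    have hcb : c (b :: A) = j := by simp [c, hbA]
    have e1 : {s | C s A = i} ∩ X ⁻¹' {x} = {s | ∀ B ∈ t, C s B = c B} := by
      ext s
      simp only [Set.mem_inter_iff, Set.mem_ofPred_eq, Set.mem_preimage, Set.mem_singleton_iff, hc]
      exact ⟨fun hs => hs.2, fun hs => ⟨(hs A hA).trans hcA, hs⟩⟩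
    have e2 : {s | C s A = i ∧ C s (b :: A) = j} ∩ X ⁻¹' {x} =
        {s | ∀ B ∈ insert (b :: A) t, C s B = c B} := by
      ext s
      simp only [Set.mem_inter_iff, Set.mem_ofPred_eq, Set.mem_preimage, Set.mem_singleton_iff, hc,
        Finset.forall_mem_insert, hcb]
      exact ⟨fun hs => ⟨hs.1.2, hs.2⟩, fun hs => ⟨⟨(hs.2 A hA).trans hcA, hs.1⟩, hs.2⟩⟩
    rw [e1, e2, h t hroot htail c, h _ (Finset.mem_insert_of_mem hroot) (by
      intro B hB
      rcases Finset.mem_insert.1 hB with rfl | hB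
      · exact Finset.mem_insert_of_mem hA
      · exact Finset.mem_insert_of_mem (htail B hB)) c,
      Finset.erase_insert_of_ne (by simp), Finset.prod_insert (by simp [hbA]), List.tail_cons,
      hcA, hcb]
    ring
  · have hempty : ∀ E : Set S, E ⊆ {s | C s A = i} → E ∩ X ⁻¹' {x} = ∅ := by
      intro E hE
      refine Set.eq_empty_of_forall_notMem fun s hs => hx ?_
      rw [← show X s = x from hs.2]
      exact hE hs.1
    rw [hempty _ fun s hs => hs.1, hempty _ subset_rfl]
    simp

variable [NeZero I]

theorem PMF.sum_ne_top_le_one_sub {p : PMF (Fin I)} {δ : ℝ≥0∞} (h : δ < p ⊤) :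
    ∑ j ∈ Finset.univ.erase ⊤, p j ≤ 1 - δ := by
  have h1 := p.tsum_coe
  rw [tsum_fintype, ← Finset.add_sum_erase _ _ (Finset.mem_univ (⊤ : Fin I))] at h1
  refine ENNReal.le_sub_of_add_le_left (h.trans_le (PMF.coe_le_one p ⊤)).ne_top ?_
  rw [← h1]
  gcongr

theorem ShrinkageParams.StochasticallyIncreasing.sum_ne_top_eq_zero
    (h : φ.StochasticallyIncreasing) (b : Bool) (A : Node) :
    ∑ j ∈ Finset.univ.erase ⊤, φ.trans (b :: A) ⊤ j = 0 :=
  Finset.sum_eq_zero fun _ hj =>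
    h _ (List.cons_ne_nil b A) _ _ (lt_top_iff_ne_top.2 (Finset.ne_of_mem_erase hj))

theorem IsMarkovTree.measure_ne_top_of_eq (h : IsMarkovTree φ P C) (hC : Measurable C) (b : Bool)
    (A : Node) (i : Fin I) :
    P {s | C s A = i ∧ C s (b :: A) ≠ ⊤} =
      P {s | C s A = i} * ∑ j ∈ Finset.univ.erase ⊤, φ.trans (b :: A) i j := by
  have hmC : ∀ B k, MeasurableSet {s | C s B = k} := fun B k =>
    ((measurable_pi_apply B).comp hC) (measurableSet_singleton k)
  have : {s | C s A = i ∧ C s (b :: A) ≠ ⊤} =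
      ⋃ j ∈ Finset.univ.erase (⊤ : Fin I), {s | C s A = i ∧ C s (b :: A) = j} := by
    ext s; simp
  rw [this, measure_biUnion_finset, Finset.mul_sum]
  · exact Finset.sum_congr rfl fun _ _ => h.measure_pair hC b A i _
  · intro _ _ _ _ hjk
    exact Set.disjoint_left.2 fun s hs hs' => hjk (hs.2.symm.trans hs'.2)
  · exact fun j _ => (hmC A i).inter (hmC _ j)

/-- The last state is absorbing. -/
theorem IsMarkovTree.ae_absorbing (h : IsMarkovTree φ P C) (hC : Measurable C)
    (hφ : φ.StochasticallyIncreasing) :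
    ∀ᵐ s ∂P, ∀ A L : Node, C s A = ⊤ → C s (L ++ A) = ⊤ := by
  have h1 : ∀ᵐ s ∂P, ∀ (b : Bool) (A : Node), C s A = ⊤ → C s (b :: A) = ⊤ := by
    refine ae_all_iff.2 fun b => ae_all_iff.2 fun A => ?_
    rw [ae_iff]
    have := h.measure_ne_top_of_eq hC b A ⊤
    rw [hφ.sum_ne_top_eq_zero, mul_zero] at this
    simpa only [Classical.not_imp] using this
  filter_upwards [h1] with s hs A L hA
  induction L with
  | nil => exact hA
  | cons b L ih => exact hs b _ ih

/-- A complete parent contributes nothing, and from any other state the child becomes complete with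
probability more than `δ`. -/
theorem IsMarkovTree.measure_cons_ne_top_le (h : IsMarkovTree φ P C) (hC : Measurable C)
    (hφ : φ.StochasticallyIncreasing) {δ : ℝ≥0∞} (b : Bool) (A : Node)
    (hδ : ∀ i : Fin I, i ≠ ⊤ → δ < φ.trans (b :: A) i ⊤) :
    P {s | C s (b :: A) ≠ ⊤} ≤ (1 - δ) * P {s | C s A ≠ ⊤} := by
  have hmC : ∀ B k, MeasurableSet {s | C s B = k} := fun B k =>
    ((measurable_pi_apply B).comp hC) (measurableSet_singleton k)
  have e1 : P {s | C s (b :: A) ≠ ⊤} ≤ ∑ i, P {s | C s A = i ∧ C s (b :: A) ≠ ⊤} := by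
    refine (measure_mono ?_).trans (measure_biUnion_finset_le _ _)
    intro s hs
    simpa using hs
  have e2 : P {s | C s A ≠ ⊤} = ∑ i ∈ Finset.univ.erase (⊤ : Fin I), P {s | C s A = i} := by
    rw [← measure_biUnion_finset ?_ fun j _ => hmC A j]
    · congr 1
      ext s
      simp
    · intro _ _ _ _ hjk
      exact Set.disjoint_left.2 fun s hs hs' => hjk (Eq.trans (Eq.symm hs) hs')
  refine e1.trans ?_
  rw [e2, ← Finset.add_sum_erase _ _ (Finset.mem_univ (⊤ : Fin I)), h.measure_ne_top_of_eq hC,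
    hφ.sum_ne_top_eq_zero, mul_zero, zero_add, Finset.mul_sum]
  refine Finset.sum_le_sum fun i hi => ?_
  rw [h.measure_ne_top_of_eq hC, mul_comm]
  gcongr
  exact PMF.sum_ne_top_le_one_sub (hδ i (Finset.ne_of_mem_erase hi))

theorem IsMarkovTree.measure_ne_top_le_pow [IsProbabilityMeasure P] (h : IsMarkovTree φ P C)
    (hC : Measurable C) (hφ : φ.StochasticallyIncreasing) {δ : ℝ≥0∞} {K : ℕ}
    (hδ : ∀ A : Node, K ≤ A.length → ∀ i : Fin I, i ≠ ⊤ → δ < φ.trans A i ⊤) (A : Node) :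
    P {s | C s A ≠ ⊤} ≤ (1 - δ) ^ (A.length - K) := by
  induction A with
  | nil => simpa using prob_le_one
  | cons b A ih =>
    -- Up to level `K` the truncated subtraction makes the exponent zero and the bound trivial; each
    -- later level contributes one factor.
    by_cases hK : K ≤ A.length
    · have e : (b :: A).length - K = A.length - K + 1 := by simp; omega
      rw [e, pow_succ']
      refine (h.measure_cons_ne_top_le hC hφ b A (hδ _ (by simp; omega))).trans ?_
      gcongr
    · have e : (b :: A).length - K = 0 := by simp; omega
      rw [e, pow_zero]
      exact prob_le_one

end MarkovTree

/-! ### The mass of a node -/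

/-- The mass of a node that results from successive splits in the proportions `x`. -/
noncomputable def splitMass (x : Node → ℝ) : Node → ℝ≥0∞
  | [] => 1
  | b :: A => splitMass x A * splitFactor b (x A)

/-- The product runs over the strict ancestors of `A`. The set and the directions do not depend on
`x`, so one formula serves both `θ` and the coefficients of `Q₀`; the length bound keeps the
ancestors distinct in the induction. -/
theorem exists_splitMass_eq_prod (A : Node) :
    ∃ (t : Finset Node) (d : Node → Bool), (∀ B ∈ t, B.length < A.length) ∧
      ∀ x, splitMass x A = ∏ B ∈ t, splitFactor (d B) (x B) := by
  classical
  induction A with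
  | nil => exact ⟨∅, fun _ => false, by simp, fun x => rfl⟩
  | cons b A ih =>
    obtain ⟨t, d, ht, hx⟩ := ih
    have hA : A ∉ t := fun h => lt_irrefl _ (ht A h)
    refine ⟨insert A t, Function.update d A b, ?_, fun x => ?_⟩
    · intro B hB
      rcases Finset.mem_insert.1 hB with rfl | hB
      · simp
      · exact (ht B hB).trans (by simp)
    · rw [Finset.prod_insert hA, Function.update_self, splitMass, hx, mul_comm]
      congr 1
      refine Finset.prod_congr rfl fun B hB => ?_
      rw [Function.update_of_ne (ne_of_mem_of_not_mem hB hA)]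

theorem measurable_splitMass (A : Node) : Measurable fun x : Node → ℝ => splitMass x A := by
  induction A with
  | nil => exact measurable_const
  | cons b A ih => exact ih.mul ((measurable_splitFactor b).comp (measurable_pi_apply A))

theorem PartitionTree.measure_cell_eq_splitMass {Ω : Type u} [MeasurableSpace Ω]
    (T : PartitionTree Ω) (q : ProbabilityMeasure Ω) {x : Node → ℝ}
    (h : ∀ A, (q : Measure Ω) (T.cell (false :: A)) =
        (q : Measure Ω) (T.cell A) * ENNReal.ofReal (x A) ∧
      (q : Measure Ω) (T.cell (true :: A)) =
        (q : Measure Ω) (T.cell A) * ENNReal.ofReal (1 - x A)) (A : Node) :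
    (q : Measure Ω) (T.cell A) = splitMass x A := by
  induction A with
  | nil => simp [T.cell_root, splitMass]
  | cons b A ih =>
    cases b
    · rw [(h A).1, ih]; rfl
    · rw [(h A).2, ih]; rfl

/-! ### The hierarchical model -/

namespace IsMarkovAPTModel

variable {Ω : Type u} [MeasurableSpace Ω] {S : Type*} [MeasurableSpace S] {I : ℕ}
  {T : PartitionTree Ω} {φ : ShrinkageParams I} {Q₀ : ProbabilityMeasure Ω} {P : Measure S}
  {C : S → Node → Fin I} {ν : S → Node → ℝ≥0∞} {θ : S → Node → ℝ} {Q : S → ProbabilityMeasure Ω}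

theorem ae_shrinkage_ne_zero (h : IsMarkovAPTModel T φ Q₀ P C ν θ Q) :
    ∀ᵐ s ∂P, ∀ A, ν s A ≠ 0 := by
  refine ae_all_iff.2 fun A => ?_
  have := h.shrinkage {A} Set.univ (fun _ => {0}) .univ fun _ => measurableSet_singleton _
  simp only [Set.mem_univ, true_and, Finset.mem_singleton, forall_eq, Set.mem_singleton_iff,
    Finset.prod_singleton, φ.F_zero, lintegral_zero] at this
  simpa [ae_iff] using this

theorem ae_measure_cell_eq (h : IsMarkovAPTModel T φ Q₀ P C ν θ Q) :
    ∀ᵐ s ∂P, ∀ A, (Q s : Measure Ω) (T.cell A) = splitMass (θ s) A :=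
  h.split.mono fun s hs => T.measure_cell_eq_splitMass (Q s) hs

/-- Given the states, the expected mass of a node is its mass under `Q₀`. -/
theorem setLIntegral_splitMass (h : IsMarkovAPTModel T φ Q₀ P C ν θ Q)
    {E : Set (Node → Fin I)} (hE : MeasurableSet E) (A : Node) :
    ∫⁻ s in {s | C s ∈ E}, splitMass (θ s) A ∂P =
      P {s | C s ∈ E} * (Q₀ : Measure Ω) (T.cell A) := by
  obtain ⟨t, d, -, hx⟩ := exists_splitMass_eq_prod A
  have hθ : ∀ B, Measurable fun s => θ s B := fun B => (measurable_pi_apply B).comp h.measurable_θ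
  have hκ : ∀ B, Measurable fun s => betaMeanPrec (T.pac Q₀ B) (ν s B) := fun B =>
    (measurable_betaMeanPrec (T.pac_nonneg Q₀ B) (T.pac_le_one Q₀ B)).comp
      ((measurable_pi_apply B).comp h.measurable_ν)
  -- Restricting `P` to the event on the states turns `coefficients` into the rectangle hypothesis.
  have key := lintegral_prod_eq_of_rectangles (P.restrict {s | C s ∈ E}) t hθ hκ (fun D hD => by
    have hm : MeasurableSet {s | ∀ B ∈ t, θ s B ∈ D B} := by
      have : {s | ∀ B ∈ t, θ s B ∈ D B} = ⋂ B ∈ t, (fun s => θ s B) ⁻¹' D B := by ext; simp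
      rw [this]
      exact Finset.measurableSet_biInter _ fun B _ => hθ B (hD B)
    have := h.coefficients t (Prod.fst ⁻¹' E) D (measurable_fst hE) hD
    rw [Measure.restrict_apply hm, Set.inter_comm]
    exact this) fun B => measurable_splitFactor (d B)
  simp_rw [hx, key]
  -- Every factor has mean `θ₀`, so the precisions drop out and the product telescopes to the
  -- constant `Q₀(A)`.
  have hae : ∀ᵐ s ∂P.restrict {s | C s ∈ E},
      ∏ B ∈ t, ∫⁻ x, splitFactor (d B) x ∂betaMeanPrec (T.pac Q₀ B) (ν s B) =
        (Q₀ : Measure Ω) (T.cell A) := by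
    filter_upwards [ae_restrict_of_ae h.ae_shrinkage_ne_zero] with s hs
    rw [T.measure_cell_eq_splitMass Q₀ (x := T.pac Q₀)
      (fun B => ⟨T.measure_cell_false Q₀ B, T.measure_cell_true Q₀ B⟩), hx]
    exact Finset.prod_congr rfl fun B _ =>
      lintegral_splitFactor_betaMeanPrec (T.pac_nonneg Q₀ B) (T.pac_le_one Q₀ B) (hs B) (d B)
  rw [lintegral_congr_ae hae, lintegral_const, Measure.restrict_apply_univ, mul_comm]

/-- The expected mass of such a cell is zero, and there are countably many nodes. This covers the
complete cells of `Q₀`-mass zero, where proportionality is vacuous. -/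
theorem ae_measure_cell_eq_zero (h : IsMarkovAPTModel T φ Q₀ P C ν θ Q) :
    ∀ᵐ s ∂P, ∀ A, (Q₀ : Measure Ω) (T.cell A) = 0 → (Q s : Measure Ω) (T.cell A) = 0 := by
  have h1 : ∀ᵐ s ∂P, ∀ A, (Q₀ : Measure Ω) (T.cell A) = 0 → splitMass (θ s) A = 0 := by
    refine ae_all_iff.2 fun A => ?_
    by_cases hA : (Q₀ : Measure Ω) (T.cell A) = 0
    · have := h.setLIntegral_splitMass (E := Set.univ) .univ A
      simp only [Set.mem_univ, Set.ofPred_true, Measure.restrict_univ, hA, mul_zero] at this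
      rw [lintegral_eq_zero_iff (f := fun s => splitMass (θ s) A)
        ((measurable_splitMass A).comp h.measurable_θ)] at this
      filter_upwards [this] with s hs _ using hs
    · exact Filter.Eventually.of_forall fun s hA' => absurd hA' hA
  filter_upwards [h1, h.ae_measure_cell_eq] with s hs hQ A hA
  rw [hQ A, hs A hA]

variable [NeZero I]

/-- In a complete shrinkage state the probability assignment coefficients are those of `Q₀`. -/
theorem ae_coefficient_eq_pac (h : IsMarkovAPTModel T φ Q₀ P C ν θ Q)
    (h_complete : ∀ A : Node, φ.F A ⊤ = Measure.dirac ∞) :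
    ∀ᵐ s ∂P, ∀ A, C s A = ⊤ → θ s A = T.pac Q₀ A := by
  refine ae_all_iff.2 fun A => ?_
  have hmC : MeasurableSet {c : Node → Fin I | c A = ⊤} :=
    measurable_pi_apply A (measurableSet_singleton ⊤)
  have h1 : ∀ᵐ s ∂P, C s A = ⊤ → ν s A = ∞ := by
    have := h.shrinkage {A} {c | c A = ⊤} (fun _ => {∞}ᶜ) hmC
      fun _ => (measurableSet_singleton _).compl
    rw [setLIntegral_congr_fun (s := {s | C s ∈ {c : Node → Fin I | c A = ⊤}})
      (f := fun s => ∏ B ∈ {A}, φ.F B (C s B) {∞}ᶜ) (g := fun _ => 0) (h.measurable_C hmC)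
      fun s hs => by
      dsimp only
      rw [Finset.prod_singleton, show C s A = ⊤ from hs, h_complete,
        Measure.dirac_apply' _ (measurableSet_singleton _).compl]
      simp] at this
    simpa [ae_iff] using this
  have h2 : ∀ᵐ s ∂P, ν s A = ∞ → θ s A = T.pac Q₀ A := by
    have hm : MeasurableSet {p : (Node → Fin I) × (Node → ℝ≥0∞) | p.2 A = ∞} :=
      (measurableSet_singleton ∞).preimage ((measurable_pi_apply A).comp measurable_snd)
    have := h.coefficients {A} {p | p.2 A = ∞} (fun _ => {T.pac Q₀ A}ᶜ) hm
      fun _ => (measurableSet_singleton _).compl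
    rw [setLIntegral_congr_fun
      (s := {s | (C s, ν s) ∈ {p : (Node → Fin I) × (Node → ℝ≥0∞) | p.2 A = ∞}})
      (f := fun s => ∏ B ∈ {A}, betaMeanPrec (T.pac Q₀ B) (ν s B) {T.pac Q₀ A}ᶜ) (g := fun _ => 0)
      ((h.measurable_C.prodMk h.measurable_ν) hm)
      fun s hs => by
        dsimp only
        rw [Finset.prod_singleton, betaMeanPrec, if_pos (Or.inl (show ν s A = ∞ from hs)),
          Measure.dirac_apply' _ (measurableSet_singleton _).compl]
        simp] at this
    simpa [ae_iff] using this
  filter_upwards [h1, h2] with s hs hs' hC using hs' (hs hC)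

theorem ae_restrict_absolutelyContinuous (h : IsMarkovAPTModel T φ Q₀ P C ν θ Q)
    (h_incr : φ.StochasticallyIncreasing)
    (h_complete : ∀ A : Node, φ.F A ⊤ = Measure.dirac ∞) :
    ∀ᵐ s ∂P, ∀ A, C s A = ⊤ → (Q s : Measure Ω).restrict (T.cell A) ≪ (Q₀ : Measure Ω) := by
  filter_upwards [h.ae_measure_cell_eq_zero, h.ae_coefficient_eq_pac h_complete,
    h.states.ae_absorbing h.measurable_C h_incr, h.split] with s h0 hθ habs hsplit A hA
  refine T.restrict_cell_absolutelyContinuous Q₀ (Q s) A (h0 A) fun L => ?_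
  have := hsplit (L ++ A)
  rwa [hθ _ (habs A L hA)] at this

/-- The expected mass of the nodes that have not reached complete shrinkage. -/
theorem lintegral_tsum_indicator_le (h : IsMarkovAPTModel T φ Q₀ P C ν θ Q)
    (h_incr : φ.StochasticallyIncreasing) {δ : ℝ≥0∞} {K : ℕ}
    (hδ : ∀ A : Node, K ≤ A.length → ∀ i : Fin I, i ≠ ⊤ → δ < φ.trans A i ⊤) (k : ℕ) :
    ∫⁻ s, ∑' A : {A : Node // A.length = k},
      {s | C s A.1 = ⊤}ᶜ.indicator (fun s => splitMass (θ s) A.1) s ∂P ≤ (1 - δ) ^ (k - K) := by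
  have := h.isProbabilityMeasure
  have hmc : ∀ A : Node, MeasurableSet {c : Node → Fin I | c A ≠ ⊤} := fun A =>
    ((measurableSet_singleton (⊤ : Fin I)).preimage (measurable_pi_apply A)).compl
  have hm : ∀ A : Node, MeasurableSet {s | C s A = ⊤}ᶜ := fun A => h.measurable_C (hmc A)
  rw [lintegral_tsum fun A : {A : Node // A.length = k} =>
    ((show Measurable fun s => splitMass (θ s) A.1 from
      (measurable_splitMass A.1).comp h.measurable_θ).indicator (hm A.1)).aemeasurable]
  calc ∑' A : {A : Node // A.length = k},
        ∫⁻ s, {s | C s A.1 = ⊤}ᶜ.indicator (fun s => splitMass (θ s) A.1) s ∂P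
      ≤ ∑' A : {A : Node // A.length = k}, (1 - δ) ^ (k - K) * (Q₀ : Measure Ω) (T.cell A.1) := by
        refine ENNReal.tsum_le_tsum fun A => ?_
        rw [lintegral_indicator (hm A.1)]
        -- Incompleteness is an event of the states alone, so the expectation factors into its
        -- probability times `Q₀(A)`.
        refine (h.setLIntegral_splitMass (hmc A.1) A.1).trans_le ?_
        gcongr
        have := h.states.measure_ne_top_le_pow h.measurable_C h_incr hδ A.1
        rwa [show A.1.length = k from A.2] at this
    _ = (1 - δ) ^ (k - K) := by
        rw [ENNReal.tsum_mul_left, ← measure_iUnion (T.pairwise_disjoint_cell k)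
          fun A => T.measurableSet_cell A.1, T.iUnion_cell_level, measure_univ, mul_one]

theorem ae_absolutelyContinuous (h : IsMarkovAPTModel T φ Q₀ P C ν θ Q)
    (h_incr : φ.StochasticallyIncreasing)
    (h_complete : ∀ A : Node, φ.F A ⊤ = Measure.dirac ∞)
    (h_trans : ∃ δ : ℝ≥0∞, 0 < δ ∧ ∃ K : ℕ, ∀ A : Node, K ≤ A.length →
      ∀ i : Fin I, i ≠ ⊤ → δ < φ.trans A i ⊤) :
    ∀ᵐ s ∂P, (Q s : Measure Ω) ≪ (Q₀ : Measure Ω) := by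
  obtain ⟨δ, hδ0, K, hδ⟩ := h_trans
  -- The incomplete mass is written through `θ`, whose measurability is part of the model; that of
  -- `Q` is not.
  let R : ℕ → S → ℝ≥0∞ := fun k s => ∑' A : {A : Node // A.length = k},
      {s | C s A.1 = ⊤}ᶜ.indicator (fun s => splitMass (θ s) A.1) s
  have hR : ∀ k, Measurable (R k) := fun k => Measurable.tsum fun A =>
    ((measurable_splitMass A.1).comp h.measurable_θ).indicator
      (h.measurable_C (measurable_pi_apply A.1 (measurableSet_singleton (⊤ : Fin I)))).compl
  -- If `δ ≥ 1`, truncated subtraction gives `1 - δ = 0`, so only `δ > 0` matters.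
  have hlim : Filter.Tendsto (fun n : ℕ => (1 - δ) ^ n) Filter.atTop (nhds 0) :=
    ENNReal.tendsto_pow_atTop_nhds_zero_of_lt_one
      (ENNReal.sub_lt_self ENNReal.one_ne_top one_ne_zero hδ0.ne')
  have hint : ∫⁻ s, ⨅ k, R k s ∂P = 0 := by
    rw [← nonpos_iff_eq_zero]
    refine ge_of_tendsto' hlim fun n => ?_
    refine (lintegral_mono fun s => iInf_le _ (n + K)).trans ?_
    have := h.lintegral_tsum_indicator_le h_incr hδ (n + K)
    rwa [Nat.add_sub_cancel] at this
  rw [lintegral_eq_zero_iff (Measurable.iInf hR)] at hint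
  filter_upwards [hint, h.ae_restrict_absolutelyContinuous h_incr h_complete,
    h.ae_measure_cell_eq] with s hs hac hQ
  refine T.absolutelyContinuous_of_cells _ _ {A | C s A = ⊤} hac ?_
  refine Eq.trans (iInf_congr fun k => tsum_congr fun A => ?_) hs
  by_cases hA : C s A.1 = ⊤
  · rw [Set.indicator_of_notMem (by simpa using hA), Set.indicator_of_notMem (by simpa using hA)]
  · rw [Set.indicator_of_mem (by simpa using hA), Set.indicator_of_mem (by simpa using hA), hQ]

end IsMarkovAPTModel

theorem mainTheorem3 {Ω : Type u} [MeasurableSpace Ω] (T : PartitionTree Ω)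
    (I : ℕ) [NeZero I] (φ : ShrinkageParams I) (Q₀ : ProbabilityMeasure Ω)
    (h_incr : φ.StochasticallyIncreasing)
    (h_complete : ∀ A : Node, φ.F A ⊤ = Measure.dirac ∞)
    (h_trans : ∃ δ : ℝ≥0∞, 0 < δ ∧ ∃ K : ℕ, ∀ A : Node, K ≤ A.length →
      ∀ i : Fin I, i ≠ ⊤ → δ < φ.trans A i ⊤)
    {S : Type*} [MeasurableSpace S] (P : Measure S) (Q : S → ProbabilityMeasure Ω)
    (π : Measure (ProbabilityMeasure Ω)) (hQ : HasLaw Q π P) (hπ : IsMarkovAPT T φ Q₀ π) :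
    (∀ᵐ s ∂P, (Q s : Measure Ω) ≪ (Q₀ : Measure Ω)) ∧
      ∀ μ : Measure Ω, (Q₀ : Measure Ω) ≪ μ → ∀ᵐ s ∂P, (Q s : Measure Ω) ≪ μ := by
  obtain ⟨S', _, P', C, ν, θ, Q', hM, hQ'⟩ := hπ
  have := T.countablyGenerated
  -- The given `Q` shares only its law with the model. As absolute continuity is a measurable event,
  -- it passes from the model to `π`, and from there to `Q`.
  have hac : ∀ᵐ q : ProbabilityMeasure Ω ∂π, (q : Measure Ω) ≪ (Q₀ : Measure Ω) := by
    rw [← hQ'.map_eq, ae_map_iff hQ'.aemeasurable (measurableSet_absolutelyContinuous_const Q₀)]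
    exact hM.ae_absolutelyContinuous h_incr h_complete h_trans
  have hac' : ∀ᵐ s ∂P, (Q s : Measure Ω) ≪ (Q₀ : Measure Ω) := by
    rw [← hQ.map_eq] at hac
    exact ae_of_ae_map hQ.aemeasurable hac
  exact ⟨hac', fun μ hμ => hac'.mono fun s hs => hs.trans hμ⟩
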